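/- Let $k$ be a commutative noetherian complete local ring with maximal ideal $\mathfrak m$, let $E=E(k/\mathfrak m)$ be an injective envelope of the $k$-module $k/\mathfrak m$, and write $D=\operatorname{Hom}_k(-,E)$. Let $\Lambda$ be a $k$-algebra which is finitely generated as a $k$-module. Let $M$ and $N$ be right $\Lambda$-modules with $M$ finitely presented, and let $P_1\xrightarrow{f}P_0\to M\to 0$ be an exact sequence of right $\Lambda$-modules with $P_0,P_1$ finitely generated projective. Let $\operatorname{Tr}M$ be the transpose of $M$ relative to this presentation, i.e. the left $\Lambda$-module defined by the exact sequence $$\operatorname{Hom}_\Lambda(P_0,\Lambda)\xrightarrow{\;\varphi\mapsto\varphi f\;}\operatorname{Hom}_\Lambda(P_1,\Lambda)\to\operatorname{Tr}M\to 0,$$ and regard $D\operatorname{Tr}M$ as a right $\Lambda$-module. For right $\Lambda$-modules $N,X$ let $\overline{\operatorname{Hom}}_\Lambda(N,X)$ be the quotient of $\operatorname{Hom}_\Lambda(N,X)$ by the submodule of all maps which factor through an injective $\Lambda$-module. Then there is an isomorphism of $k$-modules $$D\operatorname{Ext}^1_\Lambda(M,N)\;\cong\;\overline{\operatorname{Hom}}_\Lambda(N,D\operatorname{Tr}M).$$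 -/

import Mathlib

open CategoryTheory CategoryTheory.Abelian MulOpposite
open scoped ModuleCat.Algebra

universe u

namespace ARFormula

/-! Right modules over a ring `Λ` are modules over `Λᵐᵒᵖ`; left modules over `Λ` are modules over
`Λ`. -/

/-- `ι : A → E` is an injective envelope of the `k`-module `A`: the module `E` is injective, `ι` is
a monomorphism, and its image is an essential submodule of `E`. -/
structure IsInjectiveEnvelope {k A E : Type u} [CommRing k] [AddCommGroup A] [Module k A]
    [AddCommGroup E] [Module k E] (ι : A →ₗ[k] E) : Prop where
  injective_target : Module.Injective k E
  injective_map : Function.Injective ι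
  essential : ∀ S : Submodule k E, S ⊓ LinearMap.range ι = ⊥ → S = ⊥

/-- The duality `D = Hom_k(-, E)`. -/
abbrev D (k E X : Type u) [CommRing k] [AddCommGroup E] [Module k E] [AddCommGroup X]
    [Module k X] : Type u :=
  X →ₗ[k] E

section Dual

variable {k Λ E X : Type u} [CommRing k] [Ring Λ] [AddCommGroup E] [Module k E]
  [AddCommGroup X] [Module k X] [Module Λ X] [SMulCommClass Λ k X]

/-- For a left `Λ`-module `X`, the dual `D X` is a right `Λ`-module by `(f · a)(x) = f (a x)`. -/
instance instModuleD : Module Λᵐᵒᵖ (D k E X) where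
  smul a f :=
    { toFun := fun x => f (unop a • x)
      map_add' := fun x y => by rw [smul_add, map_add]
      map_smul' := fun c x => by rw [smul_comm, map_smul, RingHom.id_apply] }
  one_smul f := LinearMap.ext fun x => congrArg f (one_smul Λ x)
  mul_smul a b f := LinearMap.ext fun x => congrArg f (mul_smul (unop b) (unop a) x)
  smul_zero _ := rfl
  smul_add _ _ _ := rfl
  add_smul a b f := LinearMap.ext fun x =>
    (congrArg f (add_smul (unop a) (unop b) x)).trans (map_add f _ _)
  zero_smul f := LinearMap.ext fun x => (congrArg f (zero_smul Λ x)).trans (map_zero f)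

theorem op_smul_D_apply (a : Λ) (f : D k E X) (x : X) : (op a • f) x = f (a • x) := rfl

instance instSMulCommClassD : SMulCommClass Λᵐᵒᵖ k (D k E X) where
  smul_comm _ _ _ := rfl

end Dual

section Transpose

variable {Λ : Type u} [Ring Λ] {P₁ P₀ : Type u} [AddCommGroup P₁] [Module Λᵐᵒᵖ P₁]
  [AddCommGroup P₀] [Module Λᵐᵒᵖ P₀]

/-- For a map `f : P₁ → P₀` of right `Λ`-modules, the induced map of left `Λ`-modules
`Hom_Λ(P₀, Λ) → Hom_Λ(P₁, Λ)`, `φ ↦ φ ∘ f`. -/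
def starMap (f : P₁ →ₗ[Λᵐᵒᵖ] P₀) : (P₀ →ₗ[Λᵐᵒᵖ] Λ) →ₗ[Λ] (P₁ →ₗ[Λᵐᵒᵖ] Λ) where
  toFun φ := φ ∘ₗ f
  map_add' _ _ := rfl
  map_smul' _ _ := rfl

/-- The transpose relative to a presentation `P₁ → P₀ → M → 0` with first map `f`: the left
`Λ`-module which is the cokernel of `Hom_Λ(P₀, Λ) → Hom_Λ(P₁, Λ)`. -/
abbrev Tr (f : P₁ →ₗ[Λᵐᵒᵖ] P₀) : Type u :=
  (P₁ →ₗ[Λᵐᵒᵖ] Λ) ⧸ LinearMap.range (starMap f)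

end Transpose

section StableHom

variable (k R : Type u) [CommRing k] [Ring R] (N X : Type u) [AddCommGroup N] [Module R N]
  [AddCommGroup X] [Module R X] [Module k X] [SMulCommClass R k X]

/-- The `k`-submodule of `Hom_R(N, X)` of all maps which factor through an injective `R`-module. -/
def factorsThroughInjective : Submodule k (N →ₗ[R] X) where
  carrier := {h | ∃ (I : Type u) (_ : AddCommGroup I) (_ : Module R I), Module.Injective R I ∧
    ∃ (a : N →ₗ[R] I) (b : I →ₗ[R] X), h = b ∘ₗ a}
  zero_mem' := ⟨PUnit, inferInstance, inferInstance,
    ⟨fun _ _ _ _ _ _ _ _ _ => ⟨0, fun _ => rfl⟩⟩, 0, 0, by simp⟩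
  add_mem' := by
    rintro _ _ ⟨I, _, _, hI, a, b, rfl⟩ ⟨J, _, _, hJ, a', b', rfl⟩
    refine ⟨I × J, inferInstance, inferInstance, ⟨?_⟩, a.prod a', b.coprod b', ?_⟩
    · intro Y Z _ _ _ _ f hf g
      obtain ⟨h₁, e₁⟩ := hI.out f hf (LinearMap.fst R I J ∘ₗ g)
      obtain ⟨h₂, e₂⟩ := hJ.out f hf (LinearMap.snd R I J ∘ₗ g)
      exact ⟨h₁.prod h₂, fun y => Prod.ext (e₁ y) (e₂ y)⟩
    · ext x
      simp
  smul_mem' := by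
    rintro c _ ⟨I, _, _, hI, a, b, rfl⟩
    exact ⟨I, _, _, hI, a, c • b, rfl⟩

/-- The `k`-module of morphisms `N → X` in the stable module category modulo injectives. -/
abbrev StableHom : Type u :=
  (N →ₗ[R] X) ⧸ factorsThroughInjective k R N X

end StableHom

end ARFormula

/-! Let `C(N)` be the cokernel of `Hom(P₀, N) → Hom(P₁, N)`. Since `P₀`, `P₁` are finitely generated
projective, `C(N)` plays the role of `N ⊗ Tr M`, and tensor-hom adjunction becomes an isomorphism `D
C(N) ≅ Hom(N, D Tr M)` natural in `N`; dual bases prove it without tensor products. Inside `C(N)`,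
`Ext¹(M, N)` is the set of classes of maps killing `ker f`. As `E` is injective, `D C(N) → D Ext¹(M,
N)` is onto, with kernel the functionals vanishing on these classes. These functionals correspond to
the maps factoring through an injective: for injective `I` such classes vanish in `C(I)`, and for an
embedding of `N` in an injective `J` they contain the kernel of `C(N) → C(J)`, so the functional
extends to `C(J)`. -/

namespace ARFormula

/-- A finitely generated projective right `Λ`-module has a finite dual basis. -/
theorem exists_dualBasis (Λ P : Type u) [Ring Λ] [AddCommGroup P] [Module Λᵐᵒᵖ P]
    [Module.Finite Λᵐᵒᵖ P] [Module.Projective Λᵐᵒᵖ P] :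
    ∃ (n : ℕ) (p : Fin n → P) (q : Fin n → (P →ₗ[Λᵐᵒᵖ] Λ)),
      ∀ x, ∑ i, op (q i x) • p i = x := by
  obtain ⟨n, π, σ, -, -, h⟩ := Module.Finite.exists_comp_eq_id_of_projective Λᵐᵒᵖ P
  refine ⟨n, fun i => π (Pi.single i 1), fun i =>
    { toFun := fun x => unop (σ x i)
      map_add' := fun x y => by simp
      map_smul' := fun a x => by simp }, fun x => ?_⟩
  have hx : π (σ x) = x := LinearMap.congr_fun h x
  conv_rhs => rw [← hx, LinearMap.pi_apply_eq_sum_univ π (σ x)]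
  refine Finset.sum_congr rfl fun i _ => congrArg (fun v => σ x i • π v) ?_
  ext j
  simp [Pi.single_apply, eq_comm]

/-- A map into an injective module which vanishes on the kernel of `u` factors through `u`. -/
theorem exists_comp_eq_of_ker_le {R A B I : Type u} [Ring R] [AddCommGroup A] [Module R A]
    [AddCommGroup B] [Module R B] [AddCommGroup I] [Module R I] (hI : Module.Injective R I)
    (u : A →ₗ[R] B) (F : A →ₗ[R] I) (h : LinearMap.ker u ≤ LinearMap.ker F) :
    ∃ G : B →ₗ[R] I, G ∘ₗ u = F := by
  obtain ⟨G, hG⟩ := hI.out ((LinearMap.ker u).liftQ u le_rfl)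
    (LinearMap.ker_eq_bot.1 (Submodule.ker_liftQ_eq_bot _ _ _ le_rfl))
    ((LinearMap.ker u).liftQ F h)
  exact ⟨G, LinearMap.ext fun x => hG (Submodule.Quotient.mk x)⟩

/-- A map which vanishes on the kernel of a surjective map `u` factors through `u`. -/
theorem exists_comp_eq_of_surjective {R A B I : Type u} [Ring R] [AddCommGroup A] [Module R A]
    [AddCommGroup B] [Module R B] [AddCommGroup I] [Module R I] (u : A →ₗ[R] B)
    (hu : Function.Surjective u) (F : A →ₗ[R] I) (h : LinearMap.ker u ≤ LinearMap.ker F) :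
    ∃ G : B →ₗ[R] I, ∀ x, G (u x) = F x := by
  refine ⟨(LinearMap.ker u).liftQ F h ∘ₗ (u.quotKerEquivOfSurjective hu).symm.toLinearMap,
    fun x => ?_⟩
  have hx : (u.quotKerEquivOfSurjective hu).symm (u x) = (LinearMap.ker u).mkQ x := by
    rw [LinearEquiv.symm_apply_eq]
    rfl
  rw [LinearMap.comp_apply, LinearEquiv.coe_coe, hx, Submodule.mkQ_apply, Submodule.liftQ_apply]

/-! ### The cokernel `C(N)` and its functoriality in `N` -/

section Cokernel

variable {k R : Type u} [CommRing k] [Ring R] {P₁ P₀ : Type u} [AddCommGroup P₁] [Module R P₁]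
  [AddCommGroup P₀] [Module R P₀] (f : P₁ →ₗ[R] P₀)
  {N X : Type u} [AddCommGroup N] [Module R N] [Module k N] [SMulCommClass R k N]
  [AddCommGroup X] [Module R X] [Module k X] [SMulCommClass R k X]

variable (k N) in
/-- Composition with `f : P₁ → P₀` as a `k`-linear map `Hom_R(P₀, N) → Hom_R(P₁, N)`. -/
def precomp : (P₀ →ₗ[R] N) →ₗ[k] (P₁ →ₗ[R] N) where
  toFun φ := φ ∘ₗ f
  map_add' _ _ := rfl
  map_smul' _ _ := rfl

variable (k N) in
/-- The cokernel of `Hom_R(P₀, N) → Hom_R(P₁, N)`. -/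
abbrev HomCoker : Type u := (P₁ →ₗ[R] N) ⧸ LinearMap.range (precomp k f N)

variable (k) in
/-- A map which commutes with the actions of `R` and `k` induces a map of cokernels. -/
def homCokerMap (a : N →ₗ[R] X) (ha : ∀ (c : k) (n : N), a (c • n) = c • a n) :
    HomCoker k f N →ₗ[k] HomCoker k f X :=
  Submodule.mapQ _ _
    { toFun := fun θ => a ∘ₗ θ
      map_add' := fun θ η => LinearMap.comp_add θ η a
      map_smul' := fun c θ => LinearMap.ext fun x => ha c (θ x) }
    (by rintro _ ⟨φ, rfl⟩; exact ⟨a ∘ₗ φ, rfl⟩)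

theorem homCokerMap_mk (a : N →ₗ[R] X) (ha : ∀ (c : k) (n : N), a (c • n) = c • a n)
    (θ : P₁ →ₗ[R] N) :
    homCokerMap k f a ha (Submodule.Quotient.mk θ) = Submodule.Quotient.mk (a ∘ₗ θ) := rfl

/-- Maps into an injective module which vanish on the kernel of `f` are zero in the cokernel. -/
theorem mk_eq_zero_of_injective (hN : Module.Injective R N) (θ : P₁ →ₗ[R] N)
    (hθ : LinearMap.ker f ≤ LinearMap.ker θ) :
    (Submodule.Quotient.mk θ : HomCoker k f N) = 0 :=
  (Submodule.Quotient.mk_eq_zero _).2 (exists_comp_eq_of_ker_le hN f θ hθ)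

/-- For an injective map `N → X`, classes in the kernel of the induced map of cokernels are
represented by maps which vanish on the kernel of `f`. -/
theorem ker_le_ker_of_homCokerMap_mk_eq_zero (a : N →ₗ[R] X)
    (ha : ∀ (c : k) (n : N), a (c • n) = c • a n) (inj : Function.Injective a)
    (θ : P₁ →ₗ[R] N) (h : homCokerMap k f a ha (Submodule.Quotient.mk θ) = 0) :
    LinearMap.ker f ≤ LinearMap.ker θ := by
  rw [homCokerMap_mk, Submodule.Quotient.mk_eq_zero] at h
  obtain ⟨ψ, hψ⟩ := h
  intro x hx
  have h := LinearMap.congr_fun hψ x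
  rw [LinearMap.mem_ker] at hx ⊢
  exact inj (h.symm.trans ((congrArg ψ hx).trans (by rw [map_zero, map_zero])))

end Cokernel

/-! ### Rank-one maps, standing in for elements of `N ⊗ Hom(P, Λ)` -/

section RankOne

variable {Λ P N : Type u} [Ring Λ] [AddCommGroup P] [Module Λᵐᵒᵖ P] [AddCommGroup N]
  [Module Λᵐᵒᵖ N]

/-- The map `P → N`, `x ↦ n · p(x)`, for an element `n` of `N` and `p : P → Λ`. -/
def rankOne (n : N) (p : P →ₗ[Λᵐᵒᵖ] Λ) : P →ₗ[Λᵐᵒᵖ] N where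
  toFun x := op (p x) • n
  map_add' x y := by rw [map_add, MulOpposite.op_add, add_smul]
  map_smul' a x := by
    rw [map_smul, RingHom.id_apply, smul_smul, ← op_unop a, op_smul_eq_mul, op_mul]

theorem rankOne_apply (n : N) (p : P →ₗ[Λᵐᵒᵖ] Λ) (x : P) : rankOne n p x = op (p x) • n := rfl

theorem rankOne_op_smul (a : Λ) (n : N) (p : P →ₗ[Λᵐᵒᵖ] Λ) :
    rankOne (op a • n) p = rankOne n (a • p) := by
  ext x
  rw [rankOne_apply, rankOne_apply, smul_smul, ← op_mul, LinearMap.smul_apply, smul_eq_mul]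

theorem rankOne_add_left (n n' : N) (p : P →ₗ[Λᵐᵒᵖ] Λ) :
    rankOne (n + n') p = rankOne n p + rankOne n' p :=
  LinearMap.ext fun _ => smul_add _ _ _

theorem rankOne_add_right (n : N) (p q : P →ₗ[Λᵐᵒᵖ] Λ) :
    rankOne n (p + q) = rankOne n p + rankOne n q :=
  LinearMap.ext fun x => by
    simp only [rankOne_apply, LinearMap.add_apply, MulOpposite.op_add, add_smul]

theorem sum_rankOne {n : ℕ} {p : Fin n → P} {q : Fin n → (P →ₗ[Λᵐᵒᵖ] Λ)}
    (h : ∀ x, ∑ i, op (q i x) • p i = x) (θ : P →ₗ[Λᵐᵒᵖ] N) :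
    ∑ i, rankOne (θ (p i)) (q i) = θ := by
  ext x
  conv_rhs => rw [← h x]
  simp [rankOne_apply, LinearMap.sum_apply]

theorem sum_smul_dual {n : ℕ} {p : Fin n → P} {q : Fin n → (P →ₗ[Λᵐᵒᵖ] Λ)}
    (h : ∀ x, ∑ i, op (q i x) • p i = x) (φ : P →ₗ[Λᵐᵒᵖ] Λ) :
    ∑ i, φ (p i) • q i = φ := by
  ext x
  conv_rhs => rw [← h x]
  simp [LinearMap.sum_apply]

end RankOne

/-! ### The adjunction `D C(N) ≅ Hom(N, D Tr f)` -/

section Pairing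

variable {k Λ E : Type u} [CommRing k] [Ring Λ] [Algebra k Λ] [AddCommGroup E] [Module k E]
  {P₁ P₀ : Type u} [AddCommGroup P₁] [Module Λᵐᵒᵖ P₁] [AddCommGroup P₀] [Module Λᵐᵒᵖ P₀]
  (f : P₁ →ₗ[Λᵐᵒᵖ] P₀)
  {N X : Type u} [AddCommGroup N] [Module Λᵐᵒᵖ N] [Module k N] [IsScalarTower k Λᵐᵒᵖ N]
  [AddCommGroup X] [Module Λᵐᵒᵖ X] [Module k X] [IsScalarTower k Λᵐᵒᵖ X]

theorem rankOne_smul_right {P : Type u} [AddCommGroup P] [Module Λᵐᵒᵖ P] (c : k) (n : N)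
    (p : P →ₗ[Λᵐᵒᵖ] Λ) : rankOne n (c • p) = c • rankOne n p :=
  LinearMap.ext fun x => by
    rw [LinearMap.smul_apply, rankOne_apply, rankOne_apply, LinearMap.smul_apply,
      MulOpposite.op_smul, smul_assoc]

variable (k) in
/-- The map `Tr f → Coker(Hom_Λ(P₀, N) → Hom_Λ(P₁, N))`, `[p] ↦ [x ↦ n · p(x)]`. -/
def trPairing (n : N) : Tr f →ₗ[k] HomCoker k f N where
  toFun := QuotientAddGroup.map _ _
    { toFun := rankOne n
      map_zero' := LinearMap.ext fun x => by simp [rankOne_apply]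
      map_add' := rankOne_add_right n }
    (by rintro _ ⟨φ, rfl⟩; exact ⟨rankOne n φ, rfl⟩)
  map_add' := map_add _
  map_smul' c t := by
    induction t using Submodule.Quotient.induction_on with
    | H p => exact congrArg Submodule.Quotient.mk (rankOne_smul_right c n p)

theorem trPairing_mk (n : N) (p : P₁ →ₗ[Λᵐᵒᵖ] Λ) :
    trPairing k f n (Submodule.Quotient.mk p) = Submodule.Quotient.mk (rankOne n p) := rfl

theorem dualTr_ext {F G : D k E (Tr f)}
    (h : ∀ p, F (Submodule.Quotient.mk p) = G (Submodule.Quotient.mk p)) : F = G :=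
  LinearMap.ext fun t => Submodule.Quotient.induction_on _ t h

variable (k E N) in
/-- The natural map `D Coker(Hom_Λ(P₀, N) → Hom_Λ(P₁, N)) → Hom_Λ(N, D Tr f)`. -/
def dualCokerMap : D k E (HomCoker k f N) →ₗ[k] (N →ₗ[Λᵐᵒᵖ] D k E (Tr f)) where
  toFun F :=
    { toFun := fun n => F ∘ₗ trPairing k f n
      map_add' := fun n n' => dualTr_ext f fun p => by
        simp only [LinearMap.comp_apply, LinearMap.add_apply, trPairing_mk, rankOne_add_left,
          Submodule.Quotient.mk_add, map_add]
      map_smul' := fun a n => dualTr_ext f fun p =>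
        congrArg (fun y => F (Submodule.Quotient.mk y)) (rankOne_op_smul (unop a) n p) }
  map_add' _ _ := rfl
  map_smul' _ _ := rfl

theorem dualCokerMap_apply (F : D k E (HomCoker k f N)) (n : N) (p : P₁ →ₗ[Λᵐᵒᵖ] Λ) :
    dualCokerMap k E f N F n (Submodule.Quotient.mk p) =
      F (Submodule.Quotient.mk (rankOne n p)) := rfl

/-- Naturality in `N`: it translates factoring a map through `X` into factoring a functional through
`C(X)`. -/
theorem dualCokerMap_comp (a : N →ₗ[Λᵐᵒᵖ] X) (ha : ∀ (c : k) (n : N), a (c • n) = c • a n)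
    (G : D k E (HomCoker k f X)) :
    dualCokerMap k E f N (G ∘ₗ homCokerMap k f a ha) = dualCokerMap k E f X G ∘ₗ a :=
  LinearMap.ext fun n => dualTr_ext f fun _ =>
    congrArg (fun y => G (Submodule.Quotient.mk y)) (LinearMap.ext fun _ => map_smul a _ n)

/-- A dual basis of `P₁` shows that rank-one classes span `C(N)`. -/
theorem dualCokerMap_injective [Module.Finite Λᵐᵒᵖ P₁] [Module.Projective Λᵐᵒᵖ P₁] :
    Function.Injective (dualCokerMap k E f N) := by
  rw [← LinearMap.ker_eq_bot, LinearMap.ker_eq_bot']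
  intro F hF
  obtain ⟨n, p, q, h⟩ := exists_dualBasis Λ P₁
  refine LinearMap.ext fun y => ?_
  induction y using Submodule.Quotient.induction_on with
  | H θ =>
    rw [← sum_rankOne h θ, ← Submodule.mkQ_apply, map_sum, map_sum, LinearMap.zero_apply]
    refine Finset.sum_eq_zero fun i _ => ?_
    rw [Submodule.mkQ_apply, ← dualCokerMap_apply, hF]
    rfl

theorem dualCokerMap_surjective [Module.Finite Λᵐᵒᵖ P₁] [Module.Projective Λᵐᵒᵖ P₁]
    [Module.Finite Λᵐᵒᵖ P₀] [Module.Projective Λᵐᵒᵖ P₀] :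
    Function.Surjective (dualCokerMap k E f N) := by
  intro h
  obtain ⟨m, p, q, hpq⟩ := exists_dualBasis Λ P₁
  obtain ⟨m', p', q', hpq'⟩ := exists_dualBasis Λ P₀
  have key (n : N) (φ : P₁ →ₗ[Λᵐᵒᵖ] Λ) :
      ∑ i, h (op (φ (p i)) • n) (Submodule.Quotient.mk (q i)) = h n (Submodule.Quotient.mk φ) := by
    conv_rhs => rw [← sum_smul_dual hpq φ, ← Submodule.mkQ_apply, map_sum, map_sum]
    refine Finset.sum_congr rfl fun i _ => ?_
    rw [map_smul, op_smul_D_apply]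
    rfl
  -- The formula is forced by `sum_rankOne`, which expands `θ` into rank-one maps.
  let F₀ : (P₁ →ₗ[Λᵐᵒᵖ] N) →ₗ[k] E :=
    { toFun := fun θ => ∑ i, h (θ (p i)) (Submodule.Quotient.mk (q i))
      map_add' := fun θ η => by
        simp only [LinearMap.add_apply, map_add, Finset.sum_add_distrib]
      map_smul' := fun c θ => by
        -- `k` acts on `N` through `Λᵐᵒᵖ`, so `Λᵐᵒᵖ`-linearity of `h` yields `k`-linearity.
        have hc (n : N) (t : Tr f) : h (c • n) t = c • h n t := by
          rw [← one_smul Λᵐᵒᵖ n, ← smul_assoc, ← op_one, ← MulOpposite.op_smul, map_smul,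
            op_smul_D_apply, op_one, one_smul, ← (h n).map_smul]
          congr 1
          induction t using Submodule.Quotient.induction_on with
          | H p => exact congrArg Submodule.Quotient.mk (LinearMap.ext fun x => by simp)
        simp only [LinearMap.smul_apply, hc, Finset.smul_sum, RingHom.id_apply] }
  have hF₀ : LinearMap.range (precomp k f N) ≤ LinearMap.ker F₀ := by
    rintro _ ⟨ψ, rfl⟩
    rw [LinearMap.mem_ker]
    change ∑ i, h (ψ (f (p i))) (Submodule.Quotient.mk (q i)) = 0
    -- Expand `f (p i)` in the dual basis of `P₀`; `key` then collapses the sum over `i` to values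
    -- at the classes of `q' j ∘ₗ f`, which are zero in `Tr f`.
    have hi (i : Fin m) : h (ψ (f (p i))) (Submodule.Quotient.mk (q i)) =
        ∑ j, h (op ((q' j ∘ₗ f) (p i)) • ψ (p' j)) (Submodule.Quotient.mk (q i)) := by
      conv_lhs => rw [← hpq' (f (p i)), map_sum, map_sum, LinearMap.sum_apply]
      simp only [map_smul, LinearMap.comp_apply]
    rw [Finset.sum_congr rfl fun i _ => hi i, Finset.sum_comm]
    refine Finset.sum_eq_zero fun j _ => ?_
    have hj : (Submodule.Quotient.mk (q' j ∘ₗ f) : Tr f) = 0 :=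
      (Submodule.Quotient.mk_eq_zero _).2 ⟨q' j, rfl⟩
    rw [key, hj, map_zero]
  exact ⟨Submodule.liftQ _ F₀ hF₀, LinearMap.ext fun n => dualTr_ext f fun φ => key n φ⟩

/-- The map `N → D Tr f` given by a functional on the cokernel of `Hom_Λ(P₀, N) → Hom_Λ(P₁, N)`
factors through an injective module if and only if the functional vanishes on the classes of all
maps which are zero on the kernel of `f`. -/
theorem dualCokerMap_mem_factorsThroughInjective_iff (hE : Module.Injective k E)
    [Module.Finite Λᵐᵒᵖ P₁] [Module.Projective Λᵐᵒᵖ P₁]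
    [Module.Finite Λᵐᵒᵖ P₀] [Module.Projective Λᵐᵒᵖ P₀] (F : D k E (HomCoker k f N)) :
    dualCokerMap k E f N F ∈ factorsThroughInjective k Λᵐᵒᵖ N (D k E (Tr f)) ↔
      ∀ θ : P₁ →ₗ[Λᵐᵒᵖ] N, LinearMap.ker f ≤ LinearMap.ker θ →
        F (Submodule.Quotient.mk θ) = 0 := by
  -- The injective module comes without a `k`-action; restricting along `k → Λᵐᵒᵖ` supplies one, so
  -- that the adjunction applies to it.
  have tower (I : Type u) [AddCommGroup I] [Module Λᵐᵒᵖ I] :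
      letI := Module.compHom I (algebraMap k Λᵐᵒᵖ)
      IsScalarTower k Λᵐᵒᵖ I :=
    letI := Module.compHom I (algebraMap k Λᵐᵒᵖ)
    ⟨fun c a x => by rw [Algebra.smul_def, mul_smul]; rfl⟩
  constructor
  · rintro ⟨I, _, _, hI, a, b, hab⟩ θ hθ
    let := Module.compHom I (algebraMap k Λᵐᵒᵖ)
    have := tower I
    obtain ⟨G, rfl⟩ := dualCokerMap_surjective (k := k) f b
    rw [← dualCokerMap_comp f a (fun c n => a.map_smul_of_tower c n)] at hab
    rw [dualCokerMap_injective f hab, LinearMap.comp_apply, homCokerMap_mk,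
      mk_eq_zero_of_injective f hI, map_zero]
    exact fun x hx => (congrArg a (hθ hx)).trans (map_zero a)
  · intro hF
    obtain ⟨⟨J, hJ, ι, hι⟩⟩ := EnoughInjectives.presentation (ModuleCat.of Λᵐᵒᵖ N)
    let : Module k J := Module.compHom J (algebraMap k Λᵐᵒᵖ)
    have : IsScalarTower k Λᵐᵒᵖ J := tower J
    let a : N →ₗ[Λᵐᵒᵖ] J := ι.hom
    have ha : Function.Injective a := (ModuleCat.mono_iff_injective ι).1 hι
    obtain ⟨G, hG⟩ := exists_comp_eq_of_ker_le hE
      (homCokerMap k f a fun c n => a.map_smul_of_tower c n) F (by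
        intro y hy
        induction y using Submodule.Quotient.induction_on with
        | H θ => exact hF θ (ker_le_ker_of_homCokerMap_mk_eq_zero f a _ ha θ hy))
    exact ⟨J, inferInstance, inferInstance, (Module.injective_iff_injective_object _ _).2 hJ, a,
      dualCokerMap k E f J G, by rw [← dualCokerMap_comp f a fun c n => a.map_smul_of_tower c n, hG]⟩

end Pairing

/-! ### `Ext¹(M, N)` inside `C(N)` -/

/-- For a presentation `P₁ → P₀ → M → 0` with `P₀` projective, `Ext¹_R(M, N)` is the submodule of
the cokernel of `Hom_R(P₀, N) → Hom_R(P₁, N)` given by the maps which vanish on the kernel of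
`f : P₁ → P₀`. -/
theorem exists_ext_embedding {k R : Type u} [CommRing k] [Ring R] [Algebra k R]
    {M P₁ P₀ : Type u} [AddCommGroup M] [Module R M] [AddCommGroup P₁] [Module R P₁]
    [AddCommGroup P₀] [Module R P₀] [Module.Projective R P₀] (N : ModuleCat.{u} R)
    (f : P₁ →ₗ[R] P₀) (g : P₀ →ₗ[R] M) (hfg : Function.Exact f g)
    (hg : Function.Surjective g) :
    ∃ j : Ext (ModuleCat.of R M) N 1 →ₗ[k] HomCoker k f N, Function.Injective j ∧
      ∀ y, y ∈ LinearMap.range j ↔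
        ∃ θ : P₁ →ₗ[R] N, LinearMap.ker f ≤ LinearMap.ker θ ∧ Submodule.Quotient.mk θ = y := by
  have hS : g.shortComplexKer.ShortExact := LinearMap.shortExact_shortComplexKer hg
  have : Projective g.shortComplexKer.X₂ :=
    (inferInstance : Projective (ModuleCat.of R P₀))
  let δ : (LinearMap.ker g →ₗ[R] N) →ₗ[k] Ext (ModuleCat.of R M) N 1 :=
    { toFun := fun φ => hS.extClass.comp
        (Ext.mk₀ (ModuleCat.ofHom φ : g.shortComplexKer.X₁ ⟶ N)) (add_zero 1)
      map_add' := fun φ ψ => by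
        rw [ModuleCat.ofHom_add, Ext.mk₀_add, Ext.comp_add]
      map_smul' := fun c φ => by
        rw [RingHom.id_apply, ← Ext.comp_smul, ← Ext.mk₀_smul]
        rfl }
  -- `Ext¹(P₀, N) = 0` because `P₀` is projective.
  have hδ : Function.Surjective δ := fun x => by
    obtain ⟨y, hy⟩ := Ext.contravariant_sequence_exact₃ hS N x (Ext.eq_zero_of_projective _)
      (add_zero 1)
    obtain ⟨φ, rfl⟩ := Ext.homEquiv₀.symm.surjective y
    exact ⟨φ.hom, hy⟩
  have hδ0 (φ : LinearMap.ker g →ₗ[R] N) :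
      δ φ = 0 ↔ ∃ ψ : P₀ →ₗ[R] N, ψ ∘ₗ (LinearMap.ker g).subtype = φ := by
    constructor
    · intro h
      obtain ⟨y, hy⟩ := Ext.contravariant_sequence_exact₁ hS N _ (add_zero 1) h
      obtain ⟨ψ, rfl⟩ := Ext.homEquiv₀.symm.surjective y
      refine ⟨ψ.hom, ?_⟩
      have hy : (Ext.mk₀ g.shortComplexKer.f).comp (Ext.mk₀ ψ) (zero_add 0) = _ := hy
      rw [Ext.mk₀_comp_mk₀] at hy
      exact congrArg ModuleCat.Hom.hom (Ext.homEquiv₀.symm.injective hy)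
    · rintro ⟨ψ, rfl⟩
      have h : (Ext.mk₀ (ModuleCat.ofHom (ψ ∘ₗ (LinearMap.ker g).subtype) :
          g.shortComplexKer.X₁ ⟶ N)) = (Ext.mk₀ g.shortComplexKer.f).comp
            (Ext.mk₀ (ModuleCat.ofHom ψ : g.shortComplexKer.X₂ ⟶ N)) (zero_add 0) := by
        rw [Ext.mk₀_comp_mk₀]
        rfl
      exact (congrArg (fun z => hS.extClass.comp z (add_zero 1)) h).trans
        (hS.extClass_comp_assoc _)
  let f' : P₁ →ₗ[R] LinearMap.ker g := f.codRestrict _ fun x => hfg.apply_apply_eq_zero x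
  have hf' : Function.Surjective f' := fun ⟨y, hy⟩ => by
    obtain ⟨x, rfl⟩ := (hfg y).1 hy
    exact ⟨x, rfl⟩
  let α : (LinearMap.ker g →ₗ[R] N) →ₗ[k] HomCoker k f N :=
    Submodule.mkQ _ ∘ₗ precomp k f' N
  -- Since `f'` is onto `ker g`, `ψ` extends `φ` from `ker g` exactly when `ψ ∘ f = φ ∘ f'`.
  have hα : LinearMap.ker α = LinearMap.ker δ := by
    ext φ
    rw [LinearMap.mem_ker, LinearMap.mem_ker, hδ0]
    refine (Submodule.Quotient.mk_eq_zero _).trans (exists_congr fun ψ => ?_)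
    refine ⟨fun h => LinearMap.ext fun y => ?_, fun h => ?_⟩
    · obtain ⟨x, rfl⟩ := hf' y
      exact LinearMap.congr_fun h x
    · rw [← h]
      rfl
  obtain ⟨j, hj⟩ := exists_comp_eq_of_surjective δ hδ α hα.ge
  refine ⟨j, LinearMap.ker_eq_bot.1 (LinearMap.ker_eq_bot'.2 fun x hx => ?_), fun y => ⟨?_, ?_⟩⟩
  · obtain ⟨φ, rfl⟩ := hδ x
    rw [hj] at hx
    exact hα.le hx
  · rintro ⟨x, rfl⟩
    obtain ⟨φ, rfl⟩ := hδ x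
    refine ⟨φ ∘ₗ f', fun x hx => ?_, (hj φ).symm⟩
    have : f' x = 0 := Subtype.ext hx
    rw [LinearMap.mem_ker, LinearMap.comp_apply, this, map_zero]
  · rintro ⟨θ, hθ, rfl⟩
    obtain ⟨φ, hφ⟩ := exists_comp_eq_of_surjective f' hf' θ
      ((LinearMap.ker_codRestrict _ _ _).le.trans hθ)
    exact ⟨δ φ, (hj φ).trans (congrArg Submodule.Quotient.mk (LinearMap.ext hφ))⟩

end ARFormula

/-! ### The Auslander–Reiten formula -/

theorem mainTheorem3 {k Λ E : Type u}
    [CommRing k] [IsNoetherianRing k] [IsLocalRing k]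
    [IsAdicComplete (IsLocalRing.maximalIdeal k) k]
    [Ring Λ] [Algebra k Λ] [Module.Finite k Λ]
    [AddCommGroup E] [Module k E] (ι : IsLocalRing.ResidueField k →ₗ[k] E)
    (hι : ARFormula.IsInjectiveEnvelope ι)
    {M N : Type u} [AddCommGroup M] [Module Λᵐᵒᵖ M] [AddCommGroup N] [Module Λᵐᵒᵖ N]
    {P₁ P₀ : Type u} [AddCommGroup P₁] [Module Λᵐᵒᵖ P₁] [AddCommGroup P₀] [Module Λᵐᵒᵖ P₀]
    [Module.Finite Λᵐᵒᵖ P₁] [Module.Projective Λᵐᵒᵖ P₁]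
    [Module.Finite Λᵐᵒᵖ P₀] [Module.Projective Λᵐᵒᵖ P₀]
    (f : P₁ →ₗ[Λᵐᵒᵖ] P₀) (g : P₀ →ₗ[Λᵐᵒᵖ] M)
    (hfg : Function.Exact f g) (hg : Function.Surjective g) :
    Nonempty
      (ARFormula.D k E (Ext (ModuleCat.of Λᵐᵒᵖ M) (ModuleCat.of Λᵐᵒᵖ N) 1) ≃ₗ[k]
        ARFormula.StableHom k Λᵐᵒᵖ N (ARFormula.D k E (ARFormula.Tr f))) := by
  let : Module k N := Module.compHom N (algebraMap k Λᵐᵒᵖ)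
  have : IsScalarTower k Λᵐᵒᵖ N :=
    ⟨fun c a x => by rw [Algebra.smul_def, mul_smul]; rfl⟩
  obtain ⟨j, hj, hj'⟩ := ARFormula.exists_ext_embedding (k := k) (ModuleCat.of Λᵐᵒᵖ N) f g hfg hg
  let r : ARFormula.D k E (ARFormula.HomCoker k f N) →ₗ[k]
      ARFormula.D k E (Ext (ModuleCat.of Λᵐᵒᵖ M) (ModuleCat.of Λᵐᵒᵖ N) 1) := LinearMap.lcomp k E j
  have hr : Function.Surjective r := fun G =>
    ARFormula.exists_comp_eq_of_ker_le hι.injective_target j G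
      (by rw [LinearMap.ker_eq_bot.2 hj]; exact bot_le)
  let s : ARFormula.D k E (ARFormula.HomCoker k f N) →ₗ[k]
      ARFormula.StableHom k Λᵐᵒᵖ N (ARFormula.D k E (ARFormula.Tr f)) :=
    Submodule.mkQ _ ∘ₗ ARFormula.dualCokerMap k E f N
  have hs : Function.Surjective s :=
    (Submodule.mkQ_surjective _).comp (ARFormula.dualCokerMap_surjective f)
  -- Both targets are quotients of `D C(N)`, by the functionals vanishing on the classes of maps
  -- that kill `ker f`.
  have hrs : LinearMap.ker r = LinearMap.ker s := by
    ext F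
    rw [LinearMap.mem_ker, LinearMap.mem_ker]
    refine Iff.trans ?_ ((Submodule.Quotient.mk_eq_zero _).trans
      (ARFormula.dualCokerMap_mem_factorsThroughInjective_iff f hι.injective_target F)).symm
    constructor
    · intro h θ hθ
      obtain ⟨x, hx⟩ := (hj' _).2 ⟨θ, hθ, rfl⟩
      exact (congrArg F hx).symm.trans (LinearMap.congr_fun h x)
    · intro h
      refine LinearMap.ext fun x => ?_
      obtain ⟨θ, hθ, hx⟩ := (hj' _).1 ⟨x, rfl⟩
      exact (congrArg F hx).symm.trans (h θ hθ)
  exact ⟨(r.quotKerEquivOfSurjective hr).symm ≪≫ₗ Submodule.quotEquivOfEq _ _ hrs ≪≫ₗ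
    s.quotKerEquivOfSurjective hs⟩
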